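/- A \emph{space} is a $\mathbb{Q}$-vector subspace $V\subset\mathbb{C}$ of dimension $2$ over $\mathbb{Q}$ that contains two $\mathbb{R}$-linearly independent vectors; for $\tau\in\mathbb{C}$ write $\mathbb{Q}\langle 1,\tau\rangle$ for the $\mathbb{Q}$-subspace of $\mathbb{C}$ generated by $1$ and $\tau$. Two spaces $V,W$ are \emph{homothetic} if $W=\lambda V$ for some $\lambda\in\mathbb{C}\setminus\{0\}$. Two nonzero complex numbers $v,w$ with $w/v\notin\mathbb{R}$ form a \emph{rational angle} if $\arg(w/v)$ is a rational multiple of $\pi$. A \emph{rational quadruple} of $V$ consists of four vectors $v_1,v_2,v_3,v_4\in V$ such that $v_i$ and $v_j$ form a rational angle for all $i\neq j$. A space is \emph{superrectangular} if it is homothetic to $\mathbb{Q}\langle 1,\theta\rangle$ for some root of unity $\theta$. Let $\zeta=\exp(i\pi/6)$. The two \emph{dodecagonal spaces} are $\mathbb{Q}\langle 1,\tau_1\rangle$ and $\mathbb{Q}\langle 1,\tau_2\rangle$, where \[ \tau_1=-\zeta^3+\zeta^2+\zeta-1=(i+1)\frac{\sqrt3-1}{2},\qquad \tau_2=\zeta^3-\zeta^2+\zeta-1=(i-1)\frac{3-\sqrt3}{2}.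 \] \textbf{Theorem.} Let $V$ be a space with a rational quadruple. Then $V$ is homothetic to a superrectangular space or to one of the two dodecagonal spaces. -/

import Mathlib

namespace RationalAngles

/-- A *space*: a `ℚ`-vector subspace of `ℂ` of dimension `2` over `ℚ` that contains two
`ℝ`-linearly independent vectors. -/
def IsSpace (V : Submodule ℚ ℂ) : Prop :=
  Module.finrank ℚ V = 2 ∧ ∃ v ∈ V, ∃ w ∈ V, LinearIndependent ℝ ![v, w]

/-- `W = l V` for some nonzero complex number `l`. -/
def Homothetic (V W : Submodule ℚ ℂ) : Prop :=
  ∃ l : ℂ, l ≠ 0 ∧ W = V.map (LinearMap.mulLeft ℚ l)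

/-- `v` and `w` determine a rational angle: they are nonzero, they span distinct real lines through
the origin, and the argument of `w / v` is a rational multiple of `π`. -/
def IsRationalAngle (v w : ℂ) : Prop :=
  v ≠ 0 ∧ w ≠ 0 ∧ (w / v).im ≠ 0 ∧ ∃ q : ℚ, (w / v).arg = (q : ℝ) * Real.pi

/-- `v` is a rational `n`-tuple of the space `V`. -/
def IsRationalTuple (V : Submodule ℚ ℂ) {n : ℕ} (v : Fin n → ℂ) : Prop :=
  (∀ i, v i ∈ V) ∧ ∀ i j, i ≠ j → IsRationalAngle (v i) (v j)

/-- The `ℚ`-subspace of `ℂ` generated by `1` and `t`. -/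
noncomputable def genSpace (t : ℂ) : Submodule ℚ ℂ := Submodule.span ℚ {1, t}

/-- A superrectangular space: a space homothetic to `ℚ⟨1, θ⟩` with `θ` a root of unity. -/
def IsSuperrectangular (V : Submodule ℚ ℂ) : Prop :=
  IsSpace V ∧ ∃ θ : ℂ, (∃ n : ℕ, 0 < n ∧ θ ^ n = 1) ∧ Homothetic V (genSpace θ)

/-- The primitive 12th root of unity `exp (i π / 6)`. -/
noncomputable def zeta : ℂ := Complex.exp (Complex.I * Real.pi / 6)

/-- Generator of the first dodecagonal space, equal to `(i + 1) (√3 - 1) / 2`. -/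
noncomputable def tau₁ : ℂ := -zeta ^ 3 + zeta ^ 2 + zeta - 1

/-- Generator of the second dodecagonal space, equal to `(i - 1) (3 - √3) / 2`. -/
noncomputable def tau₂ : ℂ := zeta ^ 3 - zeta ^ 2 + zeta - 1

theorem zeta_eq : zeta = (Real.sqrt 3 + Complex.I) / 2 := by
  have h : zeta = Complex.exp (((Real.pi / 6 : ℝ) : ℂ) * Complex.I) := by
    unfold zeta; congr 1; push_cast; ring
  rw [h, Complex.exp_mul_I, ← Complex.ofReal_cos, ← Complex.ofReal_sin, Real.cos_pi_div_six,
    Real.sin_pi_div_six]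
  push_cast; ring

theorem tau₁_eq : tau₁ = (Complex.I + 1) * ((Real.sqrt 3 - 1) / 2) := by
  have h3 : (Real.sqrt 3 : ℂ) ^ 2 = 3 := by
    rw [← Complex.ofReal_pow, Real.sq_sqrt (by norm_num)]; norm_num
  have hI := Complex.I_sq
  rw [tau₁, zeta_eq]
  linear_combination (-(Real.sqrt 3 : ℂ) / 8 - 3 * Complex.I / 8 + 1 / 4) * h3
    + (-3 * (Real.sqrt 3 : ℂ) / 8 - Complex.I / 8 + 1 / 4) * hI

theorem tau₂_eq : tau₂ = (Complex.I - 1) * ((3 - Real.sqrt 3) / 2) := by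
  have h3 : (Real.sqrt 3 : ℂ) ^ 2 = 3 := by
    rw [← Complex.ofReal_pow, Real.sq_sqrt (by norm_num)]; norm_num
  have hI := Complex.I_sq
  rw [tau₂, zeta_eq]
  linear_combination ((Real.sqrt 3 : ℂ) / 8 + 3 * Complex.I / 8 - 1 / 4) * h3
    + (3 * (Real.sqrt 3 : ℂ) / 8 + Complex.I / 8 - 1 / 4) * hI

end RationalAngles

namespace RationalAngles

/-! ### Absolute values of differences of roots of unity -/

/-! Attach to each vector `v i` of the quadruple the number `x i = l * (v i / conj (v i))`, where
`l` makes `x 0 = 1`. Rationality of the angles makes every `x i` a root of unity, and two of them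
differ exactly when the vectors are not parallel over the reals. The cross-ratio of the `x i` equals
that of the four lines, which is rational because `V` is two-dimensional over `ℚ`. So four distinct
roots of unity `a, b, c, d` have a rational cross-ratio.

Put P = (a-b)(c-d), Q = (a-c)(d-b), R = (a-d)(b-c), so that P+Q+R = 0. At each prime p, such a
product has absolute value at most 1, and at least 1/4 for p = 2, at least 1/3 for p = 3, more than
1/p for p ≥ 5 (`ExtendsPadic.abs_sub_pow` and its corollaries). Hence t = P/Q makes 12/t, 12t and
12/(1+t) integers, which leaves 15 values (`ratio_of_int`). Up to permuting the four points, P:Q:R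
is -2:1:1, -3:2:1 or -4:3:1.

The factors 2, 3 and 4 force near-extremal absolute values, so certain quotients of the roots have
order 2, 3 or 4. Three of the directions then determine `V` up to homothety
(`homothetic_triangleRatio`), which yields either a superrectangular or a dodecagonal space. -/

/-- A nonarchimedean absolute value on `L` that extends the `p`-adic one on `ℚ`. -/
structure ExtendsPadic {L : Type*} [Field L] (p : ℕ) (N : AbsoluteValue L ℝ) : Prop where
  nonarch : IsNonarchimedean N
  ratCast : ∀ q : ℚ, N (q : L) = (padicNorm p q : ℚ)

/-- `z` is a root of unity. -/
def IsRootOfUnity {M : Type*} [Monoid M] (z : M) : Prop := ∃ n : ℕ, 0 < n ∧ z ^ n = 1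

/-- The `p`-adic absolute value extends to every algebraic extension of `ℚ`. -/
theorem exists_extendsPadic (p : ℕ) [Fact p.Prime] (L : Type*) [Field L] [CharZero L]
    [Algebra.IsAlgebraic ℚ L] : ∃ N : AbsoluteValue L ℝ, ExtendsPadic p N := by
  let f : L →ₐ[ℚ] PadicAlgCl p := IsAlgClosed.lift
  refine ⟨(NormedField.toAbsoluteValue (PadicAlgCl p)).comp f.toRingHom.injective, ?_, ?_⟩
  · intro a b
    change ‖f (a + b)‖ ≤ max ‖f a‖ ‖f b‖
    rw [map_add]
    exact PadicAlgCl.isNonarchimedean p _ _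
  · intro q
    change ‖f (q : L)‖ = _
    rw [map_ratCast, ← map_ratCast (algebraMap ℚ_[p] (PadicAlgCl p)) q, PadicAlgCl.norm_extends,
      Padic.eq_padicNorm]

section

variable {L : Type*} [Field L] {p : ℕ} {N : AbsoluteValue L ℝ}

theorem IsRootOfUnity.ne_zero {z : L} (hz : IsRootOfUnity z) : z ≠ 0 := by
  rintro rfl
  obtain ⟨n, hn, h⟩ := hz
  simp [hn.ne'] at h

theorem IsRootOfUnity.div {z w : L} (hz : IsRootOfUnity z) (hw : IsRootOfUnity w) :
    IsRootOfUnity (z / w) := by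
  obtain ⟨n, hn, h⟩ := hz
  obtain ⟨m, hm, h'⟩ := hw
  refine ⟨n * m, Nat.mul_pos hn hm, ?_⟩
  rw [div_pow, pow_mul, h, mul_comm n m, pow_mul w, h', one_pow, one_pow, div_one]

theorem IsRootOfUnity.abs_eq_one {z : L} (hz : IsRootOfUnity z) : N z = 1 := by
  obtain ⟨n, hn, h⟩ := hz
  have : N z ^ n = 1 := by rw [← map_pow, h, map_one]
  exact (pow_eq_one_iff_of_nonneg (N.nonneg z) hn.ne').1 this

theorem ExtendsPadic.abs_sub_le_one (hN : ExtendsPadic p N) {x y : L} (hx : IsRootOfUnity x)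
    (hy : IsRootOfUnity y) : N (x - y) ≤ 1 := by
  have h := hN.nonarch x (-y)
  rw [← sub_eq_add_neg, N.map_neg, hx.abs_eq_one, hy.abs_eq_one, max_self] at h
  exact h

/-- 1 - z divides 1 - z^i, with a sum of powers of z as quotient, and such a sum has absolute value
at most 1. -/
theorem ExtendsPadic.abs_one_sub_pow_le (hN : ExtendsPadic p N) {z : L} (hz : IsRootOfUnity z)
    (i : ℕ) : N (1 - z ^ i) ≤ N (1 - z) := by
  induction i with
  | zero => simp
  | succ i ih =>
    have h : 1 - z ^ (i + 1) = (1 - z ^ i) + z ^ i * (1 - z) := by ring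
    rw [h]
    refine (hN.nonarch _ _).trans (max_le ih ?_)
    rw [map_mul, map_pow, hz.abs_eq_one, one_pow, one_mul]

/-- Primitive `n`-th roots of unity are powers of one another, so all factors 1 - w of Φ_n(1) have
the same absolute value. -/
theorem ExtendsPadic.abs_one_sub_pow_totient (hN : ExtendsPadic p N) {z : L} {n : ℕ} (hn : 0 < n)
    (hz : IsPrimitiveRoot z n) :
    N (1 - z) ^ n.totient = N ((Polynomial.cyclotomic n L).eval 1) := by
  have : NeZero n := ⟨hn.ne'⟩
  have key : ∀ a b : L, IsPrimitiveRoot a n → IsPrimitiveRoot b n → N (1 - a) ≤ N (1 - b) := by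
    intro a b ha hb
    obtain ⟨i, -, rfl⟩ := hb.eq_pow_of_pow_eq_one ha.pow_eq_one
    exact hN.abs_one_sub_pow_le ⟨n, hn, hb.pow_eq_one⟩ i
  rw [Polynomial.cyclotomic_eq_prod_X_sub_primitiveRoots hz, Polynomial.eval_prod, map_prod,
    ← hz.card_primitiveRoots, ← Finset.prod_const]
  refine Finset.prod_congr rfl fun w hw => ?_
  have hw' := (mem_primitiveRoots hn).1 hw
  simp [le_antisymm (key z w hz hw') (key w z hw' hz)]

/-- If the `d`-th power of the absolute value of the difference of two distinct roots of unity is at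
most `p⁻¹`, then their quotient has order `p ^ k` with `φ (p ^ k) ≤ d`. -/
theorem ExtendsPadic.abs_sub_pow (hp : p.Prime) (hN : ExtendsPadic p N) {x y : L}
    (hx : IsRootOfUnity x) (hy : IsRootOfUnity y) (hxy : x ≠ y) (d : ℕ) :
    (p : ℝ)⁻¹ < N (x - y) ^ d ∨ ∃ k : ℕ, IsPrimitiveRoot (y / x) (p ^ (k + 1)) ∧
      (p ^ (k + 1)).totient ≤ d ∧ N (x - y) ^ (p ^ (k + 1)).totient = (p : ℝ)⁻¹ := by
  have : Fact p.Prime := ⟨hp⟩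
  have hinv : (p : ℝ)⁻¹ < 1 := inv_lt_one_of_one_lt₀ (by exact_mod_cast hp.one_lt)
  have hNN : N (x - y) = N (1 - y / x) := by
    have : x - y = x * (1 - y / x) := by field_simp [hx.ne_zero]
    rw [this, map_mul, hx.abs_eq_one, one_mul]
  have hz := hy.div hx
  have hz1 : y / x ≠ 1 := fun h => hxy ((div_eq_one_iff_eq hx.ne_zero).1 h).symm
  obtain ⟨m, hm, hzm⟩ := hz
  have hfin : IsOfFinOrder (y / x) := isOfFinOrder_iff_pow_eq_one.2 ⟨m, hm, hzm⟩
  have hn : 0 < orderOf (y / x) := hfin.orderOf_pos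
  have hprim := IsPrimitiveRoot.orderOf (y / x)
  have htot := hN.abs_one_sub_pow_totient hn hprim
  rw [← hNN] at htot
  set n := orderOf (y / x) with hndef
  have hn1 : n ≠ 1 := fun h => hz1 (orderOf_eq_one_iff.1 h)
  have htotpos : n.totient ≠ 0 := (Nat.totient_pos.2 hn).ne'
  have hone : N ((Polynomial.cyclotomic n L).eval 1) = 1 → (p : ℝ)⁻¹ < N (x - y) ^ d := by
    intro h
    rw [h, pow_eq_one_iff_of_nonneg (N.nonneg _) htotpos] at htot
    rw [htot, one_pow]
    exact hinv
  -- For n > 1, Φ_n(1) is q when n is a power of a prime q, and 1 otherwise; only q = p can make it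
  -- small.
  by_cases hpp : ∃ q : ℕ, q.Prime ∧ ∃ k, q ^ k = n
  · obtain ⟨q, hq, k, hk⟩ := hpp
    obtain _ | k := k
    · exact absurd hk.symm (by simpa using hn1)
    have : Fact q.Prime := ⟨hq⟩
    have hqN : N ((Polynomial.cyclotomic n L).eval 1) = (padicNorm p q : ℚ) := by
      rw [← hk, Polynomial.eval_one_cyclotomic_prime_pow, ← hN.ratCast]
      simp
    by_cases hqp : p = q
    · subst hqp
      rw [hqN, padicNorm.padicNorm_p_of_prime] at htot
      push_cast at htot
      rw [← hk] at htot hprim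
      by_cases hd : (p ^ (k + 1)).totient ≤ d
      · exact .inr ⟨k, hprim, hd, htot⟩
      · left
        rw [← htot]
        have h0 : 0 < N (x - y) := N.pos (sub_ne_zero.2 hxy)
        refine pow_lt_pow_right_of_lt_one₀ h0 ?_ (not_le.1 hd)
        by_contra! h1
        have := one_le_pow₀ h1 (n := (p ^ (k + 1)).totient)
        rw [htot] at this
        exact absurd this (not_le.2 hinv)
    · left
      apply hone
      rw [hqN, padicNorm.padicNorm_of_prime_of_ne hqp, Rat.cast_one]
  · left
    apply hone
    rw [Polynomial.eval_one_cyclotomic_not_prime_pow, map_one]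
    intro q hq k hk
    exact hpp ⟨q, hq, k, hk⟩

theorem ExtendsPadic.two_abs_sub (hN : ExtendsPadic 2 N) {x y : L} (hx : IsRootOfUnity x)
    (hy : IsRootOfUnity y) (hxy : x ≠ y) :
    1 / 2 < N (x - y) ∨ (y = -x ∧ N (x - y) = 1 / 2) := by
  rcases hN.abs_sub_pow Nat.prime_two hx hy hxy 1 with h | ⟨k, hk, hd, he⟩
  · left; simpa using h
  · right
    rw [Nat.totient_prime_pow_succ Nat.prime_two] at hd he
    have hk0 : k = 0 := by
      by_contra h
      have := Nat.one_lt_pow h (show 1 < 2 by norm_num)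
      omega
    subst hk0
    have := hk.eq_neg_one_of_two_right
    rw [div_eq_iff hx.ne_zero] at this
    exact ⟨by simpa using this, by simpa using he⟩

theorem ExtendsPadic.two_abs_sub_sq (hN : ExtendsPadic 2 N) {x y : L} (hx : IsRootOfUnity x)
    (hy : IsRootOfUnity y) (hxy : x ≠ y) (hneg : y ≠ -x) :
    1 / 2 < N (x - y) ^ 2 ∨ (y ^ 2 = -x ^ 2 ∧ N (x - y) ^ 2 = 1 / 2) := by
  rcases hN.abs_sub_pow Nat.prime_two hx hy hxy 2 with h | ⟨k, hk, hd, he⟩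
  · left; simpa using h
  · right
    rw [Nat.totient_prime_pow_succ Nat.prime_two] at hd he
    have hk2 : k < 2 := by
      by_contra! h
      have := Nat.pow_le_pow_right (show 0 < 2 by norm_num) h
      omega
    interval_cases k
    · have := hk.eq_neg_one_of_two_right
      rw [div_eq_iff hx.ne_zero] at this
      exact absurd (by simpa using this) hneg
    · have h4 : IsPrimitiveRoot ((y / x) ^ 2) 2 := hk.pow (by norm_num) (by norm_num)
      have := h4.eq_neg_one_of_two_right
      rw [div_pow, div_eq_iff (pow_ne_zero _ hx.ne_zero)] at this
      exact ⟨by simpa using this, by simpa using he⟩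

theorem ExtendsPadic.three_abs_sub_sq (hN : ExtendsPadic 3 N) {x y : L} (hx : IsRootOfUnity x)
    (hy : IsRootOfUnity y) (hxy : x ≠ y) :
    1 / 3 < N (x - y) ^ 2 ∨ (x ^ 2 + x * y + y ^ 2 = 0 ∧ N (x - y) ^ 2 = 1 / 3) := by
  rcases hN.abs_sub_pow Nat.prime_three hx hy hxy 2 with h | ⟨k, hk, hd, he⟩
  · left; simpa using h
  · right
    rw [Nat.totient_prime_pow_succ Nat.prime_three] at hd he
    have hk0 : k = 0 := by
      by_contra h
      have := Nat.one_lt_pow h (show 1 < 3 by norm_num)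
      omega
    subst hk0
    have h3 := hk.pow_eq_one
    rw [div_pow, div_eq_one_iff_eq (pow_ne_zero _ hx.ne_zero)] at h3
    refine ⟨?_, by simpa using he⟩
    have : (x - y) * (x ^ 2 + x * y + y ^ 2) = 0 := by linear_combination -h3
    exact (mul_eq_zero.1 this).resolve_left (sub_ne_zero.2 hxy)

theorem ExtendsPadic.five_abs_sub_sq (hp : p.Prime) (hp5 : 5 ≤ p) (hN : ExtendsPadic p N) {x y : L}
    (hx : IsRootOfUnity x) (hy : IsRootOfUnity y) (hxy : x ≠ y) :
    (p : ℝ)⁻¹ < N (x - y) ^ 2 := by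
  rcases hN.abs_sub_pow hp hx hy hxy 2 with h | ⟨k, hk, hd, he⟩
  · exact h
  · rw [Nat.totient_prime_pow_succ hp] at hd
    have : p - 1 ≤ p ^ k * (p - 1) := Nat.le_mul_of_pos_left _ (Nat.pow_pos hp.pos)
    omega

/-! ### Products of two differences of roots of unity. -/

variable {a b c d : L}

/-- Without antipodal pairs both squared factors are at least 1/2, so a squared product of at most
1/4 forces equality in each, that is, two quotients of order 4. -/
theorem ExtendsPadic.of_abs_le_half (hN : ExtendsPadic 2 N) (ha : IsRootOfUnity a)
    (hb : IsRootOfUnity b) (hc : IsRootOfUnity c) (hd : IsRootOfUnity d) (hab : a ≠ b) (hcd : c ≠ d)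
    (h : N ((a - b) * (c - d)) ≤ 1 / 2) :
    b = -a ∨ d = -c ∨ (b ^ 2 = -a ^ 2 ∧ d ^ 2 = -c ^ 2) := by
  by_cases h1 : b = -a
  · exact .inl h1
  by_cases h2 : d = -c
  · exact .inr (.inl h2)
  right; right
  have h0 := pow_le_pow_left₀ (N.nonneg _) h 2
  rw [map_mul, mul_pow] at h0
  rcases hN.two_abs_sub_sq ha hb hab h1 with h3 | ⟨h3, h3'⟩ <;>
  rcases hN.two_abs_sub_sq hc hd hcd h2 with h4 | ⟨h4, h4'⟩
  · nlinarith
  · nlinarith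
  · nlinarith
  · exact ⟨h3, h4⟩

theorem ExtendsPadic.quarter_le_abs (hN : ExtendsPadic 2 N) (ha : IsRootOfUnity a)
    (hb : IsRootOfUnity b) (hc : IsRootOfUnity c) (hd : IsRootOfUnity d) (hab : a ≠ b)
    (hcd : c ≠ d) : 1 / 4 < N ((a - b) * (c - d)) ∨
      (b = -a ∧ d = -c ∧ N ((a - b) * (c - d)) = 1 / 4) := by
  rw [map_mul]
  rcases hN.two_abs_sub ha hb hab with h3 | ⟨h3, h3'⟩ <;>
  rcases hN.two_abs_sub hc hd hcd with h4 | ⟨h4, h4'⟩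
  · left; nlinarith
  · left; nlinarith
  · left; nlinarith
  · right; rw [h3', h4']; exact ⟨h3, h4, by norm_num⟩

theorem ExtendsPadic.third_le_abs (hN : ExtendsPadic 3 N) (ha : IsRootOfUnity a)
    (hb : IsRootOfUnity b) (hc : IsRootOfUnity c) (hd : IsRootOfUnity d) (hab : a ≠ b)
    (hcd : c ≠ d) : 1 / 3 < N ((a - b) * (c - d)) ∨
      (a ^ 2 + a * b + b ^ 2 = 0 ∧ c ^ 2 + c * d + d ^ 2 = 0 ∧
        N ((a - b) * (c - d)) = 1 / 3) := by
  have key : (1 / 3 : ℝ) ^ 2 < N ((a - b) * (c - d)) ^ 2 → 1 / 3 < N ((a - b) * (c - d)) :=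
    fun h => lt_of_pow_lt_pow_left₀ 2 (N.nonneg _) h
  rw [map_mul] at key ⊢
  rw [mul_pow] at key
  rcases hN.three_abs_sub_sq ha hb hab with h3 | ⟨h3, h3'⟩ <;>
  rcases hN.three_abs_sub_sq hc hd hcd with h4 | ⟨h4, h4'⟩
  · left; apply key; nlinarith
  · left; apply key; nlinarith
  · left; apply key; nlinarith
  · right
    refine ⟨h3, h4, ?_⟩
    have : (N (a - b) * N (c - d)) ^ 2 = (1 / 3) ^ 2 := by rw [mul_pow, h3', h4']; norm_num
    exact (pow_left_inj₀ (mul_nonneg (N.nonneg _) (N.nonneg _)) (by norm_num) two_ne_zero).1 this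

theorem ExtendsPadic.inv_lt_abs (hp : p.Prime) (hp5 : 5 ≤ p) (hN : ExtendsPadic p N)
    (ha : IsRootOfUnity a) (hb : IsRootOfUnity b) (hc : IsRootOfUnity c) (hd : IsRootOfUnity d)
    (hab : a ≠ b) (hcd : c ≠ d) : (p : ℝ)⁻¹ < N ((a - b) * (c - d)) := by
  refine lt_of_pow_lt_pow_left₀ 2 (N.nonneg _) ?_
  have h1 := hN.five_abs_sub_sq hp hp5 ha hb hab
  have h2 := hN.five_abs_sub_sq hp hp5 hc hd hcd
  have h0 : (0 : ℝ) < (p : ℝ)⁻¹ := inv_pos.2 (by exact_mod_cast hp.pos)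
  rw [map_mul, mul_pow]
  nlinarith

end

/-- A rational number that is integral at every prime is an integer. -/
theorem exists_int_of_forall_padicNorm_le_one {q : ℚ}
    (h : ∀ p : ℕ, p.Prime → padicNorm p q ≤ 1) : ∃ z : ℤ, (z : ℚ) = q := by
  refine ⟨q.num, Rat.coe_int_num_of_den_eq_one ?_⟩
  by_contra hden
  obtain ⟨p, hp, hdvd⟩ := Nat.exists_prime_and_dvd hden
  have : Fact p.Prime := ⟨hp⟩
  have h1 := h p hp
  have hnum : ¬ (p : ℤ) ∣ q.num := by
    intro hn
    have := Nat.dvd_gcd (Int.natCast_dvd.1 hn) hdvd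
    rw [q.reduced] at this
    exact hp.one_lt.ne' (Nat.dvd_one.1 this)
  rw [← Rat.num_div_den q, padicNorm.div, (padicNorm.int_eq_one_iff q.num).2 hnum] at h1
  have h2 := (padicNorm.nat_lt_one_iff (p := p) q.den).2 hdvd
  have h3 : 0 < padicNorm p q.den :=
    lt_of_le_of_ne (padicNorm.nonneg _) (padicNorm.nonzero (by exact_mod_cast q.den_nz)).symm
  rw [div_le_one h3] at h1
  exact absurd h1 (not_le.2 h2)

/-! ### Divisibility consequences for proportional products. -/

section

variable {L : Type*} [Field L] [CharZero L] [Algebra.IsAlgebraic ℚ L]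

/-- The product on the right has absolute value at most 1, so |t| is at least the lower bound for
the product on the left. The constant 12 = 2²·3 collects the bounds 1/4 at 2 and 1/3 at 3. -/
theorem exists_int_of_mul_sub_eq {a b c d a' b' c' d' : L} (ha : IsRootOfUnity a)
    (hb : IsRootOfUnity b) (hc : IsRootOfUnity c) (hd : IsRootOfUnity d) (ha' : IsRootOfUnity a')
    (hb' : IsRootOfUnity b') (hc' : IsRootOfUnity c') (hd' : IsRootOfUnity d') (hab : a ≠ b)
    (hcd : c ≠ d) {t : ℚ} (h : (a - b) * (c - d) = t * ((a' - b') * (c' - d'))) :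
    ∃ z : ℤ, (z : ℚ) = 12 / t := by
  have ht : t ≠ 0 := by
    rintro rfl
    rw [Rat.cast_zero, zero_mul, mul_eq_zero, sub_eq_zero, sub_eq_zero] at h
    tauto
  refine exists_int_of_forall_padicNorm_le_one fun p hp => ?_
  have : Fact p.Prime := ⟨hp⟩
  obtain ⟨N, hN⟩ := exists_extendsPadic p L
  have htpos : 0 < padicNorm p t :=
    lt_of_le_of_ne (padicNorm.nonneg _) (padicNorm.nonzero ht).symm
  rw [padicNorm.div, div_le_one htpos]
  have hle : N ((a - b) * (c - d)) ≤ (padicNorm p t : ℚ) := by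
    rw [h, map_mul, hN.ratCast, map_mul]
    refine mul_le_of_le_one_right (by exact_mod_cast htpos.le) ?_
    exact mul_le_one₀ (hN.abs_sub_le_one ha' hb') (N.nonneg _) (hN.abs_sub_le_one hc' hd')
  have h12 : padicNorm p 12 = padicNorm p 2 * padicNorm p 2 * padicNorm p 3 := by
    rw [← padicNorm.mul, ← padicNorm.mul]; norm_num
  rcases lt_or_ge p 5 with hp5 | hp5
  · have h23 : p = 2 ∨ p = 3 := by
      have := hp.two_le
      interval_cases p
      · exact .inl rfl
      · exact .inr rfl
      · norm_num at hp
    rcases h23 with rfl | rfl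
    · have e2 : padicNorm 2 2 = (2 : ℚ)⁻¹ := by
          exact_mod_cast padicNorm.padicNorm_p_of_prime (p := 2)
      have e3 : padicNorm 2 3 = 1 := by
        exact_mod_cast padicNorm.padicNorm_of_prime_of_ne (p := 2) (q := 3) (by norm_num)
      have h4 : (1 / 4 : ℝ) ≤ N ((a - b) * (c - d)) := by
        rcases hN.quarter_le_abs ha hb hc hd hab hcd with h | ⟨-, -, h⟩
        · exact h.le
        · exact h.ge
      have h5 : ((1 / 4 : ℚ) : ℝ) ≤ (padicNorm 2 t : ℚ) := by push_cast; exact h4.trans hle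
      rw [h12, e2, e3]
      have := Rat.cast_le.1 h5
      linarith
    · have e2 : padicNorm 3 2 = 1 := by
        exact_mod_cast padicNorm.padicNorm_of_prime_of_ne (p := 3) (q := 2) (by norm_num)
      have e3 : padicNorm 3 3 = (3 : ℚ)⁻¹ := by
          exact_mod_cast padicNorm.padicNorm_p_of_prime (p := 3)
      have h4 : (1 / 3 : ℝ) ≤ N ((a - b) * (c - d)) := by
        rcases hN.third_le_abs ha hb hc hd hab hcd with h | ⟨-, -, h⟩
        · exact h.le
        · exact h.ge
      have h5 : ((1 / 3 : ℚ) : ℝ) ≤ (padicNorm 3 t : ℚ) := by push_cast; exact h4.trans hle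
      rw [h12, e2, e3]
      have := Rat.cast_le.1 h5
      linarith
  · have h4 := (hN.inv_lt_abs hp hp5 ha hb hc hd hab hcd).trans_le hle
    have h5 : ((p : ℚ)⁻¹ : ℚ) < padicNorm p t := by
      rw [← Rat.cast_lt (K := ℝ)]; push_cast; exact h4
    have h6 : padicNorm p 12 ≤ 1 := by exact_mod_cast padicNorm.of_nat (p := p) 12
    refine h6.trans ?_
    -- The values are integer powers of p, so strictly exceeding 1/p means being at least 1.
    obtain ⟨z, hz⟩ := padicNorm.values_discrete (p := p) ht
    rw [hz] at h5 ⊢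
    have hp1 : (1 : ℚ) < p := by exact_mod_cast hp.one_lt
    rw [← zpow_neg_one, zpow_lt_zpow_iff_right₀ hp1] at h5
    exact one_le_zpow₀ hp1.le (by omega)

theorem eq_neg_or_sq_eq_neg_of_mul_sub_eq {a b c d a' b' c' d' : L} (ha : IsRootOfUnity a)
    (hb : IsRootOfUnity b) (hc : IsRootOfUnity c) (hd : IsRootOfUnity d) (ha' : IsRootOfUnity a')
    (hb' : IsRootOfUnity b') (hc' : IsRootOfUnity c') (hd' : IsRootOfUnity d') (hab : a ≠ b)
    (hcd : c ≠ d) (h : (a - b) * (c - d) = 2 * ((a' - b') * (c' - d'))) :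
    b = -a ∨ d = -c ∨ (b ^ 2 = -a ^ 2 ∧ d ^ 2 = -c ^ 2) := by
  obtain ⟨N, hN⟩ := exists_extendsPadic 2 L
  refine hN.of_abs_le_half ha hb hc hd hab hcd ?_
  have h2 : N 2 = 1 / 2 := by
    have := hN.ratCast 2
    have e2 : padicNorm 2 2 = (2 : ℚ)⁻¹ := by
          exact_mod_cast padicNorm.padicNorm_p_of_prime (p := 2)
    rw [e2] at this
    simpa using this
  rw [h, map_mul, h2, map_mul]
  exact mul_le_of_le_one_right (by norm_num)
    (mul_le_one₀ (hN.abs_sub_le_one ha' hb') (N.nonneg _) (hN.abs_sub_le_one hc' hd'))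

theorem eq_neg_of_mul_sub_eq {a b c d a' b' c' d' : L} (ha : IsRootOfUnity a)
    (hb : IsRootOfUnity b) (hc : IsRootOfUnity c) (hd : IsRootOfUnity d) (ha' : IsRootOfUnity a')
    (hb' : IsRootOfUnity b') (hc' : IsRootOfUnity c') (hd' : IsRootOfUnity d') (hab : a ≠ b)
    (hcd : c ≠ d) (h : (a - b) * (c - d) = 4 * ((a' - b') * (c' - d'))) : b = -a ∧ d = -c := by
  obtain ⟨N, hN⟩ := exists_extendsPadic 2 L
  have h4 : N 4 = 1 / 4 := by
    have := hN.ratCast 2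
    have e2 : padicNorm 2 2 = (2 : ℚ)⁻¹ := by
          exact_mod_cast padicNorm.padicNorm_p_of_prime (p := 2)
    rw [e2] at this
    have h2 : N 2 = 1 / 2 := by simpa using this
    rw [show (4 : L) = 2 * 2 by norm_num, map_mul, h2]
    norm_num
  rcases hN.quarter_le_abs ha hb hc hd hab hcd with h0 | ⟨h1, h2, -⟩
  · exfalso
    rw [h, map_mul, h4, map_mul] at h0
    have := mul_le_one₀ (hN.abs_sub_le_one ha' hb') (N.nonneg _) (hN.abs_sub_le_one hc' hd')
    linarith
  · exact ⟨h1, h2⟩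

theorem sq_add_mul_add_sq_of_mul_sub_eq {a b c d a' b' c' d' : L} (ha : IsRootOfUnity a)
    (hb : IsRootOfUnity b) (hc : IsRootOfUnity c) (hd : IsRootOfUnity d) (ha' : IsRootOfUnity a')
    (hb' : IsRootOfUnity b') (hc' : IsRootOfUnity c') (hd' : IsRootOfUnity d') (hab : a ≠ b)
    (hcd : c ≠ d) (h : (a - b) * (c - d) = 3 * ((a' - b') * (c' - d'))) :
    a ^ 2 + a * b + b ^ 2 = 0 ∧ c ^ 2 + c * d + d ^ 2 = 0 := by
  obtain ⟨N, hN⟩ := exists_extendsPadic 3 L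
  have h3 : N 3 = 1 / 3 := by
    have := hN.ratCast 3
    have e2 : padicNorm 3 3 = (3 : ℚ)⁻¹ := by
          exact_mod_cast padicNorm.padicNorm_p_of_prime (p := 3)
    rw [e2] at this
    simpa using this
  rcases hN.third_le_abs ha hb hc hd hab hcd with h0 | ⟨h1, h2, -⟩
  · exfalso
    rw [h, map_mul, h3, map_mul] at h0
    have := mul_le_one₀ (hN.abs_sub_le_one ha' hb') (N.nonneg _) (hN.abs_sub_le_one hc' hd')
    linarith
  · exact ⟨h1, h2⟩

end

/-- The solutions of a two-variable unit equation with bounded exponents at `2` and `3`. -/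
theorem ratio_of_int {t : ℚ} (ht : t ≠ 0) (ht1 : 1 + t ≠ 0) (h1 : ∃ z : ℤ, (z : ℚ) = 12 / t)
    (h2 : ∃ z : ℤ, (z : ℚ) = 12 / t⁻¹) (h3 : ∃ z : ℤ, (z : ℚ) = 12 / (1 + t)) :
    t ∈ ({1, -2, -1 / 2, 2, 1 / 2, -3, -1 / 3, -3 / 2, -2 / 3, 3, 1 / 3, -4, -1 / 4, -4 / 3,
      -3 / 4} : Finset ℚ) := by
  obtain ⟨n, hn⟩ := h1
  obtain ⟨m, hm⟩ := h2
  obtain ⟨k, hk⟩ := h3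
  -- With m = 12t, the three integrality conditions say that m and m + 12 both divide 144.
  have hm' : t = m / 12 := by rw [hm]; field_simp
  have hmn : m * n = 144 := by
    have : (m * n : ℚ) = 144 := by rw [hm, hn]; field_simp; norm_num
    exact_mod_cast this
  have hmk : (m + 12) * k = 144 := by
    have : ((m + 12) * k : ℚ) = 144 := by rw [hm, hk]; field_simp; ring
    exact_mod_cast this
  have hd1 : m ∣ 144 := ⟨n, hmn.symm⟩
  have hd2 : m + 12 ∣ 144 := ⟨k, hmk.symm⟩
  have hle : m ≤ 144 := Int.le_of_dvd (by norm_num) hd1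
  have hge : -144 ≤ m := by
    have := Int.le_of_dvd (by norm_num) ((neg_dvd).2 hd1)
    omega
  have key : m ∈ (Finset.Icc (-144 : ℤ) 144).filter (fun m => m ∣ 144 ∧ m + 12 ∣ 144) :=
    Finset.mem_filter.2 ⟨Finset.mem_Icc.2 ⟨hge, hle⟩, hd1, hd2⟩
  have hset : (Finset.Icc (-144 : ℤ) 144).filter (fun m => m ∣ 144 ∧ m + 12 ∣ 144) =
      {-48, -36, -24, -18, -16, -9, -8, -6, -4, -3, 4, 6, 12, 24, 36} := by decide +kernel
  rw [hset] at key
  rw [hm']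
  fin_cases key <;> norm_num

/-! ### Spaces and their triples of directions -/

open ComplexConjugate

theorem homothetic_self (V : Submodule ℚ ℂ) : Homothetic V V :=
  ⟨1, one_ne_zero, by simp [LinearMap.mulLeft_one]⟩

/-- The parameter of the space spanned by the sides of a triangle whose sides have directions with
squares proportional to `a`, `b`, `c`. -/
def triangleRatio {L : Type*} [Field L] (a b c : L) : L := b * (a - c) / (a * (c - b))

theorem span_pair_eq_of_finrank_eq_two {V : Submodule ℚ ℂ} (hV : Module.finrank ℚ V = 2) {u v : ℂ}
    (hu : u ∈ V) (hv : v ∈ V) (huv : (v / u).im ≠ 0) : Submodule.span ℚ {u, v} = V := by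
  have hfin : FiniteDimensional ℚ V := Module.finite_of_finrank_eq_succ hV
  have hli : LinearIndependent ℚ ![u, v] := by
    rw [LinearIndependent.pair_iff]
    intro s t hst
    have hu0 : u ≠ 0 := by rintro rfl; simp at huv
    have h1 : (s : ℂ) + t * (v / u) = 0 := by
      rw [Rat.smul_def, Rat.smul_def] at hst
      field_simp
      rw [hst, mul_zero]
    have ht : t = 0 := by
      have := congrArg Complex.im h1
      simp [Complex.mul_im] at this
      tauto
    subst ht
    simpa using h1
  refine Submodule.eq_of_le_of_finrank_eq (Submodule.span_le.2 ?_) ?_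
  · rintro x (rfl | rfl)
    exacts [hu, hv]
  · have := finrank_span_eq_card hli
    rw [Matrix.range_cons, Matrix.range_cons, Matrix.range_empty, Set.union_empty,
      Set.singleton_union] at this
    rw [this, hV]
    rfl

theorem exists_rat_combination {V : Submodule ℚ ℂ} (hV : Module.finrank ℚ V = 2) {u v w : ℂ}
    (hu : u ∈ V) (hv : v ∈ V) (hw : w ∈ V) (huv : (v / u).im ≠ 0) :
    ∃ r s : ℚ, w = r * u + s * v := by
  rw [← span_pair_eq_of_finrank_eq_two hV hu hv huv, Submodule.mem_span_pair] at hw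
  obtain ⟨r, s, h⟩ := hw
  exact ⟨r, s, by rw [← h, Rat.smul_def, Rat.smul_def]⟩

theorem genSpace_rat_mul_add (t : ℂ) {r : ℚ} (hr : r ≠ 0) (s : ℚ) :
    genSpace (r * t + s) = genSpace t := by
  have hr' : (r : ℂ) ≠ 0 := by exact_mod_cast hr
  refine le_antisymm (Submodule.span_le.2 ?_) (Submodule.span_le.2 ?_)
  · rintro x (rfl | rfl)
    · exact Submodule.subset_span (by simp)
    · refine Submodule.mem_span_pair.2 ⟨s, r, ?_⟩
      rw [Rat.smul_def, Rat.smul_def]; ring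
  · rintro x (rfl | rfl)
    · exact Submodule.subset_span (by simp)
    · refine Submodule.mem_span_pair.2 ⟨-s / r, 1 / r, ?_⟩
      rw [Rat.smul_def, Rat.smul_def]; push_cast; field_simp; ring

theorem homothetic_genSpace_div {V : Submodule ℚ ℂ} (hV : Module.finrank ℚ V = 2) {u v : ℂ}
    (hu : u ∈ V) (hv : v ∈ V) (huv : (v / u).im ≠ 0) : Homothetic V (genSpace (v / u)) := by
  have hu0 : u ≠ 0 := by rintro rfl; simp at huv
  refine ⟨u⁻¹, inv_ne_zero hu0, ?_⟩
  rw [← span_pair_eq_of_finrank_eq_two hV hu hv huv, Submodule.map_span, Set.image_pair, genSpace]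
  congr 2
  · simp [hu0]
  · simp [div_eq_inv_mul]

theorem im_div_eq_zero_iff {u v : ℂ} (hu : u ≠ 0) :
    (v / u).im = 0 ↔ u * conj v = v * conj u := by
  have hu' : conj u ≠ 0 := by simpa using hu
  rw [← Complex.conj_eq_iff_im, map_div₀, div_eq_div_iff hu' hu]
  constructor <;> intro h <;> linear_combination h

/-- Writing w = ru + sv gives a triangle with sides ru, sv, w, whose side directions determine
(sv)/(ru) as in the law of sines. The rational factor s/r does not change the generated space, and
`l` cancels because `triangleRatio` is homogeneous of degree 0. -/
theorem homothetic_triangleRatio {V : Submodule ℚ ℂ} (hV : Module.finrank ℚ V = 2) {u v w l : ℂ}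
    (hl : l ≠ 0) (hu : u ∈ V) (hv : v ∈ V) (hw : w ∈ V) (huv : (v / u).im ≠ 0)
    (huw : (w / u).im ≠ 0) (hvw : (w / v).im ≠ 0) : Homothetic V (genSpace
      (triangleRatio (l * (u / conj u)) (l * (v / conj v)) (l * (w / conj w)))) := by
  have hu0 : u ≠ 0 := by rintro rfl; simp at huv
  have hv0 : v ≠ 0 := by rintro rfl; simp at huv
  have hw0 : w ≠ 0 := by rintro rfl; simp at huw
  obtain ⟨r, s, h⟩ := exists_rat_combination hV hu hv hw huv
  have hr : r ≠ 0 := by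
    rintro rfl
    apply hvw
    rw [h]
    simp [hv0]
  have hs : s ≠ 0 := by
    rintro rfl
    apply huw
    rw [h]
    simp [hu0]
  convert homothetic_genSpace_div hV hu hv huv using 1
  have hcast : ∀ q : ℚ, conj (q : ℂ) = q := fun q => map_ratCast _ q
  have h' : conj w = r * conj u + s * conj v := by rw [h]; simp [hcast]
  have huv' : u * conj v - v * conj u ≠ 0 :=
    fun h0 => huv ((im_div_eq_zero_iff hu0).2 (sub_eq_zero.1 h0))
  have hr' : (r : ℂ) ≠ 0 := by exact_mod_cast hr
  have hs' : (s : ℂ) ≠ 0 := by exact_mod_cast hs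
  have hcu : conj u ≠ 0 := by simpa using hu0
  have hcv : conj v ≠ 0 := by simpa using hv0
  have hcw : conj w ≠ 0 := by simpa using hw0
  have e : triangleRatio (l * (u / conj u)) (l * (v / conj v)) (l * (w / conj w)) =
      ((s / r : ℚ) : ℂ) * (v / u) + (0 : ℚ) := by
    have e1 : u / conj u - w / conj w = s * (u * conj v - v * conj u) / (conj u * conj w) := by
      field_simp
      rw [h', h]; ring
    have e2 : w / conj w - v / conj v = r * (u * conj v - v * conj u) / (conj v * conj w) := by
      field_simp
      rw [h', h]; ring
    rw [triangleRatio, ← mul_sub, ← mul_sub, e1, e2]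
    have huv'' : conj v * u - v * conj u ≠ 0 := by rwa [mul_comm (conj v)]
    push_cast
    field_simp
    simp
  rw [e, genSpace_rat_mul_add _ (div_ne_zero hs hr)]

theorem isRootOfUnity_div_conj {z : ℂ} (hz : z ≠ 0) {q : ℚ} (h : z.arg = (q : ℝ) * Real.pi) :
    IsRootOfUnity (z / conj z) := by
  -- Since z / conj z = exp(2i arg z) = exp(2πiq), the denominator of q suffices as exponent.
  refine ⟨q.den, q.den_pos, ?_⟩
  have hz1 := Complex.norm_mul_exp_arg_mul_I z
  have hn : (‖z‖ : ℂ) ≠ 0 := by simpa using hz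
  have hz2 : conj z = ‖z‖ * Complex.exp (-(z.arg * Complex.I)) := by
    conv_lhs => rw [← hz1]
    rw [map_mul, Complex.conj_ofReal, ← Complex.exp_conj, map_mul, Complex.conj_ofReal,
      Complex.conj_I, mul_neg]
  have : z / conj z = Complex.exp (2 * z.arg * Complex.I) := by
    rw [hz2]
    nth_rewrite 1 [← hz1]
    rw [mul_div_mul_left _ _ hn, ← Complex.exp_sub]
    congr 1
    ring
  rw [this, ← Complex.exp_nat_mul, h, Complex.exp_eq_one_iff]
  refine ⟨q.num, ?_⟩
  have hq : (q.den : ℂ) * (q : ℂ) = q.num := by exact_mod_cast Rat.den_mul_eq_num q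
  push_cast
  linear_combination (2 * Real.pi * Complex.I) * hq

/-! ### The classification -/

/-- The field of algebraic numbers. -/
abbrev AlgNumber : Type := algebraicClosure ℚ ℂ

instance : Algebra.IsAlgebraic ℚ AlgNumber := by
  have h : Algebra.IsAlgebraic (R := ℚ) (A := algebraicClosure ℚ ℂ) :=
    algebraicClosure.isAlgebraic ℚ ℂ
  convert h

/-- The squares of the normalized directions in `S` are roots of unity, and any three of them
determine the space `V` up to homothety. -/
structure IsDirectionSet (V : Submodule ℚ ℂ) (S : Set AlgNumber) : Prop where
  root : ∀ a ∈ S, IsRootOfUnity a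
  homothetic : ∀ a ∈ S, ∀ b ∈ S, ∀ c ∈ S, a ≠ b → a ≠ c → b ≠ c →
    Homothetic V (genSpace (triangleRatio (a : ℂ) b c))

/-- The conclusion of the classification. -/
def IsSuperrectangularOrDodecagonal (V : Submodule ℚ ℂ) : Prop :=
  (∃ θ : ℂ, (∃ n : ℕ, 0 < n ∧ θ ^ n = 1) ∧ Homothetic V (genSpace θ)) ∨
    Homothetic V (genSpace tau₁) ∨ Homothetic V (genSpace tau₂)

theorem zeta_quartic : zeta ^ 4 = zeta ^ 2 - 1 := by
  have h3 : (Real.sqrt 3 : ℂ) ^ 2 = 3 := by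
    rw [← Complex.ofReal_pow, Real.sq_sqrt (by norm_num)]; norm_num
  have h : zeta ^ 2 = (1 + Real.sqrt 3 * Complex.I) / 2 := by
    rw [zeta_eq]; linear_combination h3 / 4 + Complex.I_sq / 4
  rw [show zeta ^ 4 = (zeta ^ 2) ^ 2 by ring, h]
  linear_combination (Complex.I ^ 2 / 4) * h3 + (3 / 4) * Complex.I_sq

theorem zeta_cube : zeta ^ 3 = Complex.I := by
  have h3 : (Real.sqrt 3 : ℂ) ^ 2 = 3 := by
    rw [← Complex.ofReal_pow, Real.sq_sqrt (by norm_num)]; norm_num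
  have h : zeta ^ 2 = (1 + Real.sqrt 3 * Complex.I) / 2 := by
    rw [zeta_eq]; linear_combination h3 / 4 + Complex.I_sq / 4
  rw [show zeta ^ 3 = zeta ^ 2 * zeta by ring, h, zeta_eq]
  linear_combination Complex.I / 4 * h3 + Real.sqrt 3 / 4 * Complex.I_sq

/-- The arguments are squared directions: the lines lie at 0°, 45° and 15°, and bound a triangle
with angles 15°, 30°, 135°. -/
theorem triangleRatio_tau₁ {a : ℂ} (ha : a ≠ 0) :
    triangleRatio a (zeta ^ 3 * a) (zeta * a) = tau₁ := by
  have hz := zeta_quartic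
  have hne : zeta - zeta ^ 3 ≠ 0 := by
    intro h
    have h1 : (1 : ℂ) = 0 := by
      linear_combination hz + zeta * h
    exact one_ne_zero h1
  have hne' : zeta * a - zeta ^ 3 * a ≠ 0 := by
    rw [← sub_mul]; exact mul_ne_zero hne ha
  rw [triangleRatio, div_eq_iff (mul_ne_zero ha hne'), tau₁]
  linear_combination a ^ 2 * (zeta - zeta ^ 2) * hz

/-- Here the lines lie at 0°, 135° and 60°, and bound a triangle with angles 45°, 60°, 75°. -/
theorem triangleRatio_tau₂ {a : ℂ} (ha : a ≠ 0) :
    triangleRatio a (-zeta ^ 3 * a) (zeta ^ 4 * a) = tau₂ := by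
  have hz := zeta_quartic
  have hz0 : zeta ≠ 0 := by intro h; rw [h] at hz; norm_num at hz
  have hz1 : zeta + 1 ≠ 0 := by
    intro h; rw [eq_neg_of_add_eq_zero_left h] at hz; norm_num at hz
  have hne : zeta ^ 4 * a - -zeta ^ 3 * a ≠ 0 := by
    rw [show zeta ^ 4 * a - -zeta ^ 3 * a = zeta ^ 3 * (zeta + 1) * a by ring]
    exact mul_ne_zero (mul_ne_zero (pow_ne_zero _ hz0) hz1) ha
  rw [triangleRatio, div_eq_iff (mul_ne_zero ha hne), tau₂]
  ring

theorem IsDirectionSet.tau₁ {V : Submodule ℚ ℂ} {S : Set AlgNumber} (hS : IsDirectionSet V S)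
    {a b c : AlgNumber} (ha : a ∈ S) (hb : b ∈ S) (hc : c ∈ S) (hab : a ≠ b) (hac : a ≠ c)
    (hbc : b ≠ c) (h1 : (b : ℂ) = zeta ^ 3 * a) (h2 : (c : ℂ) = zeta * a) :
    IsSuperrectangularOrDodecagonal V := by
  have h := hS.homothetic a ha b hb c hc hab hac hbc
  have ha0 : (a : ℂ) ≠ 0 := by exact_mod_cast (hS.root a ha).ne_zero
  rw [h1, h2, triangleRatio_tau₁ ha0] at h
  exact .inr (.inl h)

theorem IsDirectionSet.tau₂ {V : Submodule ℚ ℂ} {S : Set AlgNumber} (hS : IsDirectionSet V S)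
    {a b c : AlgNumber} (ha : a ∈ S) (hb : b ∈ S) (hc : c ∈ S) (hab : a ≠ b) (hac : a ≠ c)
    (hbc : b ≠ c) (h1 : (b : ℂ) = -zeta ^ 3 * a) (h2 : (c : ℂ) = zeta ^ 4 * a) :
    IsSuperrectangularOrDodecagonal V := by
  have h := hS.homothetic a ha b hb c hc hab hac hbc
  have ha0 : (a : ℂ) ≠ 0 := by exact_mod_cast (hS.root a ha).ne_zero
  rw [h1, h2, triangleRatio_tau₂ ha0] at h
  exact .inr (.inr h)

/-- Two orthogonal directions and the diagonal of an equilateral rhombus. -/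
theorem IsDirectionSet.eisenstein {V : Submodule ℚ ℂ} {S : Set AlgNumber}
    (hS : IsDirectionSet V S) {a b c : AlgNumber} (ha : a ∈ S) (hb : b ∈ S) (hc : c ∈ S)
    (hab : a ≠ b) (hac : a ≠ c) (hbc : b ≠ c) (h1 : b = -a) (h2 : a ^ 2 + a * c + c ^ 2 = 0) :
    IsSuperrectangularOrDodecagonal V := by
  have h := hS.homothetic a ha b hb c hc hab hac hbc
  have ha0 : a ≠ 0 := (hS.root a ha).ne_zero
  have hca : c + a ≠ 0 := fun h0 => hbc (by rw [h1]; linear_combination -h0)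
  refine .inl ⟨((c / a : AlgNumber) : ℂ), ?_, ?_⟩
  · obtain ⟨n, hn, hn'⟩ := (hS.root c hc).div (hS.root a ha)
    exact ⟨n, hn, by exact_mod_cast hn'⟩
  -- For ω = c/a, a primitive cube root of unity, the ratio is (ω-1)/(ω+1) = 2ω+1.
  · have e : triangleRatio a b c = ((2 : ℚ) : AlgNumber) * (c / a) + ((1 : ℚ) : AlgNumber) := by
      rw [triangleRatio, h1]
      push_cast
      rw [sub_neg_eq_add, div_eq_iff (mul_ne_zero ha0 hca)]
      field_simp
      linear_combination (-2) * h2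
    have e' : triangleRatio (a : ℂ) b c =
        ((2 : ℚ) : ℂ) * ((c / a : AlgNumber) : ℂ) + ((1 : ℚ) : ℂ) := by
      have := congrArg (fun z : AlgNumber => (z : ℂ)) e
      have h2 : ((2 : AlgNumber) : ℂ) = 2 := rfl
      simpa [triangleRatio, h2] using this
    rw [e', genSpace_rat_mul_add _ two_ne_zero] at h
    exact h

/-- The condition says that direction c bisects directions a and b, so the parallelogram with sides
along a and b and diagonal along c is a rhombus: its sides differ by a rotation. -/
theorem IsDirectionSet.rhombus {V : Submodule ℚ ℂ} {S : Set AlgNumber} (hS : IsDirectionSet V S)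
    {a b c : AlgNumber} (ha : a ∈ S) (hb : b ∈ S) (hc : c ∈ S)
    (hab : a ≠ b) (hac : a ≠ c) (hbc : b ≠ c) (h : a * b = c ^ 2) :
    IsSuperrectangularOrDodecagonal V := by
  have hh := hS.homothetic a ha b hb c hc hab hac hbc
  have ha0 : a ≠ 0 := (hS.root a ha).ne_zero
  refine .inl ⟨((c / a : AlgNumber) : ℂ), ?_, ?_⟩
  · obtain ⟨n, hn, hn'⟩ := (hS.root c hc).div (hS.root a ha)
    exact ⟨n, hn, by exact_mod_cast hn'⟩
  · have e : triangleRatio a b c = c / a := by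
      rw [triangleRatio, div_eq_div_iff (mul_ne_zero ha0 (sub_ne_zero.2 hbc.symm)) ha0]
      linear_combination (a) * h
    have e' : triangleRatio (a : ℂ) b c = ((c / a : AlgNumber) : ℂ) := by
      have := congrArg (fun z : AlgNumber => (z : ℂ)) e
      simpa [triangleRatio] using this
    rwa [e'] at hh

theorem sq_eq_neg_sq_iff {z w : ℂ} : w ^ 2 = -z ^ 2 ↔ w = zeta ^ 3 * z ∨ z = zeta ^ 3 * w := by
  rw [zeta_cube]
  constructor
  · intro h
    have : (w - Complex.I * z) * (w + Complex.I * z) = 0 := by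
      linear_combination h - z ^ 2 * Complex.I_sq
    rcases mul_eq_zero.1 this with h0 | h0
    · left; linear_combination h0
    · right; linear_combination -Complex.I * h0 + z * Complex.I_sq
  · rintro (rfl | rfl)
    · linear_combination z ^ 2 * Complex.I_sq
    · linear_combination w ^ 2 * Complex.I_sq

theorem eq_zeta_sq_mul_or_of_sq_sub {z w : ℂ} (h : w ^ 2 - w * z + z ^ 2 = 0) :
    w = zeta ^ 2 * z ∨ z = zeta ^ 2 * w := by
  have hz := zeta_quartic
  have : (w - zeta ^ 2 * z) * (w + (zeta ^ 2 - 1) * z) = 0 := by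
    linear_combination h - z ^ 2 * hz
  rcases mul_eq_zero.1 this with h0 | h0
  · left; linear_combination h0
  · right; linear_combination -zeta ^ 2 * h0 + z * hz

theorem eq_zeta_pow_four_mul_or_of_sq_add {z w : ℂ} (h : w ^ 2 + w * z + z ^ 2 = 0) :
    w = zeta ^ 4 * z ∨ z = zeta ^ 4 * w := by
  have hz := zeta_quartic
  rw [hz]
  have : (w - (zeta ^ 2 - 1) * z) * (w + zeta ^ 2 * z) = 0 := by
    linear_combination h - z ^ 2 * hz
  rcases mul_eq_zero.1 this with h0 | h0
  · left; linear_combination h0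
  · right; linear_combination (1 - zeta ^ 2) * h0 + z * hz

section

variable {V : Submodule ℚ ℂ} {S : Set AlgNumber} {a b c d : AlgNumber}

theorem zeta_pow_six : zeta ^ 6 = -1 := by
  rw [show zeta ^ 6 = (zeta ^ 3) ^ 2 by ring, zeta_cube, Complex.I_sq]

theorem zeta_pow_four_ne_one : zeta ^ 4 ≠ 1 := by
  intro h
  have h2 : zeta ^ 2 = 2 := by linear_combination h - zeta_quartic
  have h4 : (4 : ℂ) = 1 := by linear_combination h - (zeta ^ 2 + 2) * h2
  norm_num at h4

theorem coe_mul_sub_eq {k : ℤ} (h : (a - b) * (c - d) = k * ((a - c) * (d - b))) :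
    ((a : ℂ) - b) * (c - d) = k * ((a - c) * (d - b)) := by
  have := congrArg (fun z : AlgNumber => (z : ℂ)) h
  simpa using this

/-! ### The three proportions P:Q:R. -/

theorem IsDirectionSet.harmonic_of_quarter_turn (hS : IsDirectionSet V S) (ha : a ∈ S) (hb : b ∈ S)
    (hc : c ∈ S) (hd : d ∈ S) (hab : a ≠ b) (had : a ≠ d) (hbc : b ≠ c) (hbd : b ≠ d)
    (hcd : c ≠ d) (h : (a - b) * (c - d) = -2 * ((a - c) * (d - b)))
    (h1 : (b : ℂ) = zeta ^ 3 * a) (h2 : (d : ℂ) = zeta ^ 3 * c) :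
    IsSuperrectangularOrDodecagonal V := by
  have hP : ((a : ℂ) - b) * (c - d) = (-2 : ℤ) * ((a - c) * (d - b)) :=
    coe_mul_sub_eq (by push_cast; exact h)
  push_cast at hP
  have hca : (c : ℂ) ^ 2 - c * a + a ^ 2 = 0 := by
    rw [zeta_cube] at h1 h2
    rw [h1, h2] at hP
    linear_combination (Complex.I / 2) * hP +
      ((a : ℂ) * c * (1 - Complex.I / 2) + (a - c) ^ 2) * Complex.I_sq
  rcases eq_zeta_sq_mul_or_of_sq_sub hca with h3 | h3
  · exact hS.tau₁ hc hd hb hcd hbc.symm hbd.symm h2 (by rw [h1, h3]; ring)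
  · exact hS.tau₁ ha hb hd hab had hbd h1 (by rw [h2, h3]; ring)

theorem IsDirectionSet.of_harmonic (hS : IsDirectionSet V S) (ha : a ∈ S) (hb : b ∈ S)
    (hc : c ∈ S) (hd : d ∈ S) (hab : a ≠ b) (hac : a ≠ c) (had : a ≠ d) (hbc : b ≠ c)
    (hbd : b ≠ d) (hcd : c ≠ d) (h : (a - b) * (c - d) = -2 * ((a - c) * (d - b))) :
    IsSuperrectangularOrDodecagonal V := by
  have ra := hS.root a ha
  have rb := hS.root b hb
  have rc := hS.root c hc
  have rd := hS.root d hd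
  have h2 : (2 : AlgNumber) ≠ 0 := two_ne_zero
  rcases eq_neg_or_sq_eq_neg_of_mul_sub_eq ra rb rc rd ra rc rb rd hab hcd
    (by linear_combination h) with h1 | h1 | ⟨h1, h1'⟩
  · refine hS.rhombus hc hd ha hcd hac.symm had.symm (mul_left_cancel₀ h2 ?_)
    rw [h1] at h
    linear_combination -h
  · refine hS.rhombus ha hb hc hab hac hbc (mul_left_cancel₀ h2 ?_)
    rw [h1] at h
    linear_combination -h
  · have e1 : (b : ℂ) ^ 2 = -a ^ 2 := by exact_mod_cast congrArg (fun z : AlgNumber => (z : ℂ)) h1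
    have e2 : (d : ℂ) ^ 2 = -c ^ 2 := by exact_mod_cast congrArg (fun z : AlgNumber => (z : ℂ)) h1'
    -- The harmonic relation is invariant under a ↔ b and under c ↔ d, so both quarter turns can be
    -- oriented alike.
    rcases sq_eq_neg_sq_iff.1 e1 with e1 | e1 <;> rcases sq_eq_neg_sq_iff.1 e2 with e2 | e2
    · exact hS.harmonic_of_quarter_turn ha hb hc hd hab had hbc hbd hcd h e1 e2
    · exact hS.harmonic_of_quarter_turn ha hb hd hc hab hac hbd hbc hcd.symm
        (by linear_combination h) e1 e2
    · exact hS.harmonic_of_quarter_turn hb ha hc hd hab.symm hbd hac had hcd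
        (by linear_combination h) e1 e2
    · exact hS.harmonic_of_quarter_turn hb ha hd hc hab.symm hbc had hac hcd.symm
        (by linear_combination h) e1 e2

theorem IsDirectionSet.of_ratio_three (hS : IsDirectionSet V S) (ha : a ∈ S) (hb : b ∈ S)
    (hc : c ∈ S) (hd : d ∈ S) (hab : a ≠ b) (hac : a ≠ c) (had : a ≠ d) (hbc : b ≠ c)
    (hbd : b ≠ d) (hcd : c ≠ d) (hP : (a - b) * (c - d) = -3 * ((a - d) * (b - c)))
    (hQ : (a - c) * (d - b) = 2 * ((a - d) * (b - c))) :
    IsSuperrectangularOrDodecagonal V := by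
  have ra := hS.root a ha
  have rb := hS.root b hb
  have rc := hS.root c hc
  have rd := hS.root d hd
  obtain ⟨h1, h2⟩ := sq_add_mul_add_sq_of_mul_sub_eq ra rb rc rd ra rd rc rb hab hcd
    (by linear_combination hP)
  rcases eq_neg_or_sq_eq_neg_of_mul_sub_eq ra rc rd rb ra rd rb rc hac hbd.symm hQ
    with h3 | h3 | ⟨h3, h4⟩
  · exact hS.eisenstein ha hc hb hac hab hbc.symm h3 h1
  · exact hS.eisenstein hb hd ha hbd hab.symm had.symm (by rw [h3, neg_neg])
      (by linear_combination h1)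
  · have e1 : (b : ℂ) ^ 2 + b * a + a ^ 2 = 0 := by
      have : b ^ 2 + b * a + a ^ 2 = 0 := by linear_combination h1
      exact_mod_cast congrArg (fun z : AlgNumber => (z : ℂ)) this
    have e2 : (d : ℂ) ^ 2 + d * c + c ^ 2 = 0 := by
      have : d ^ 2 + d * c + c ^ 2 = 0 := by linear_combination h2
      exact_mod_cast congrArg (fun z : AlgNumber => (z : ℂ)) this
    have e3 : (c : ℂ) ^ 2 = -a ^ 2 := by exact_mod_cast congrArg (fun z : AlgNumber => (z : ℂ)) h3
    have e4 : (b : ℂ) ^ 2 = -d ^ 2 := by exact_mod_cast congrArg (fun z : AlgNumber => (z : ℂ)) h4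
    have hz6 := zeta_pow_six
    have turn : ∀ {z w : ℂ}, w = zeta ^ 3 * z → z = -zeta ^ 3 * w := by
      rintro z w rfl
      linear_combination z * hz6
    -- This excludes third turns of opposite orientation: combined with the quarter turns they give
    -- z² = ζ^16 z², although ζ^16 = ζ^4 ≠ 1.
    have absurd_of : ∀ {z : ℂ}, z ≠ 0 → z ^ 2 = zeta ^ 16 * z ^ 2 → False := by
      intro z hz h
      apply zeta_pow_four_ne_one
      refine mul_right_cancel₀ (pow_ne_zero 2 hz) ?_
      linear_combination -h - zeta ^ 4 * (zeta ^ 6 - 1) * z ^ 2 * hz6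
    have ha0 : (a : ℂ) ≠ 0 := by exact_mod_cast ra.ne_zero
    have hb0 : (b : ℂ) ≠ 0 := by exact_mod_cast rb.ne_zero
    rcases eq_zeta_pow_four_mul_or_of_sq_add e1 with f1 | f1 <;> rcases eq_zeta_pow_four_mul_or_of_sq_add e2 with f2 | f2
    · rcases sq_eq_neg_sq_iff.1 e3 with f3 | f3
      · exact hS.tau₂ hc ha hd hac.symm hcd had (turn f3) f2
      · exact hS.tau₂ ha hc hb hac hab hbc.symm (turn f3) f1
    · exfalso
      apply absurd_of hb0
      rw [f1] at e4 ⊢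
      rw [f2] at e3
      linear_combination zeta ^ 8 * e3 - zeta ^ 16 * e4
    · exfalso
      apply absurd_of ha0
      rw [f1] at e3 ⊢
      rw [f2] at e4
      linear_combination zeta ^ 8 * e4 - zeta ^ 16 * e3
    · rcases sq_eq_neg_sq_iff.1 e4 with f3 | f3
      · exact hS.tau₂ hb hd ha hbd hab.symm had.symm (turn f3) f1
      · exact hS.tau₂ hd hb hc hbd.symm hcd.symm hbc (turn f3) f2

theorem IsDirectionSet.of_ratio_four (hS : IsDirectionSet V S) (ha : a ∈ S) (hb : b ∈ S)
    (hc : c ∈ S) (hd : d ∈ S) (hab : a ≠ b) (hac : a ≠ c) (hbc : b ≠ c)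
    (hbd : b ≠ d) (hcd : c ≠ d) (hP : (a - b) * (c - d) = -4 * ((a - d) * (b - c)))
    (hQ : (a - c) * (d - b) = 3 * ((a - d) * (b - c))) :
    IsSuperrectangularOrDodecagonal V := by
  have ra := hS.root a ha
  have rb := hS.root b hb
  have rc := hS.root c hc
  have rd := hS.root d hd
  obtain ⟨h1, -⟩ := eq_neg_of_mul_sub_eq ra rb rc rd ra rd rc rb hab hcd (by linear_combination hP)
  obtain ⟨h2, -⟩ := sq_add_mul_add_sq_of_mul_sub_eq ra rc rd rb ra rd rb rc hac hbd.symm hQ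
  exact hS.eisenstein ha hb hc hab hac hbc h1 h2

theorem IsDirectionSet.of_rational_crossRatio (hS : IsDirectionSet V S) (ha : a ∈ S) (hb : b ∈ S)
    (hc : c ∈ S) (hd : d ∈ S) (hab : a ≠ b) (hac : a ≠ c) (had : a ≠ d) (hbc : b ≠ c)
    (hbd : b ≠ d) (hcd : c ≠ d) {t : ℚ} (h : (a - b) * (c - d) = t * ((a - c) * (d - b))) :
    IsSuperrectangularOrDodecagonal V := by
  have ra := hS.root a ha
  have rb := hS.root b hb
  have rc := hS.root c hc
  have rd := hS.root d hd
  -- This is the identity P + Q + R = 0, in the form -R = (1+t)Q.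
  have hR : (a - d) * (c - b) = ((1 + t : ℚ) : AlgNumber) * ((a - c) * (d - b)) := by
    push_cast
    linear_combination h
  have ht : t ≠ 0 := by
    rintro rfl
    rw [Rat.cast_zero, zero_mul, mul_eq_zero, sub_eq_zero, sub_eq_zero] at h
    tauto
  have ht1 : 1 + t ≠ 0 := by
    intro h0
    rw [h0, Rat.cast_zero, zero_mul, mul_eq_zero, sub_eq_zero, sub_eq_zero] at hR
    exact hR.elim had hbc.symm
  have hinv : (a - c) * (d - b) = ((t⁻¹ : ℚ) : AlgNumber) * ((a - b) * (c - d)) := by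
    have : (t : AlgNumber) ≠ 0 := by exact_mod_cast ht
    rw [h, Rat.cast_inv, inv_mul_cancel_left₀ this]
  have key := ratio_of_int ht ht1 (exists_int_of_mul_sub_eq ra rb rc rd ra rc rd rb hab hcd h)
    (exists_int_of_mul_sub_eq ra rc rd rb ra rb rc rd hac hbd.symm hinv)
    (exists_int_of_mul_sub_eq ra rd rc rb ra rc rd rb had hbc.symm hR)
  simp only [Finset.mem_insert, Finset.mem_singleton] at key
  -- Permuting the four points permutes P, Q, R up to a common sign. The 15 values form orbits of
  -- sizes 3, 6 and 6, one for each of the proportions -2:1:1, -3:2:1 and -4:3:1.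
  rcases key with rfl | rfl | rfl | rfl | rfl | rfl | rfl | rfl | rfl | rfl | rfl | rfl | rfl |
    rfl | rfl <;> push_cast at h
  · exact hS.of_harmonic ha hd hb hc had hab hac hbd.symm hcd.symm hbc (by linear_combination h)
  · exact hS.of_harmonic ha hb hc hd hab hac had hbc hbd hcd (by linear_combination h)
  · exact hS.of_harmonic ha hc hd hb hac had hab hcd hbc.symm hbd.symm
      (by linear_combination -2 * h)
  · exact hS.of_ratio_three ha hd hb hc had hab hac hbd.symm hcd.symm hbc
      (by linear_combination -h) (by linear_combination h)
  · exact hS.of_ratio_three ha hd hc hb had hac hab hcd.symm hbd.symm hbc.symm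
      (by linear_combination -2 * h) (by linear_combination 2 * h)
  · exact hS.of_ratio_three ha hb hd hc hab had hac hbd hbc hcd.symm
      (by linear_combination -h) (by linear_combination h)
  · exact hS.of_ratio_three ha hc hd hb hac had hab hcd hbc.symm hbd.symm
      (by linear_combination 3 * h) (by linear_combination -3 * h)
  · exact hS.of_ratio_three ha hb hc hd hab hac had hbc hbd hcd
      (by linear_combination -2 * h) (by linear_combination 2 * h)
  · exact hS.of_ratio_three ha hc hb hd hac hab had hbc.symm hcd hbd
      (by linear_combination 3 * h) (by linear_combination -3 * h)
  · exact hS.of_ratio_four ha hd hb hc had hab hbd.symm hcd.symm hbc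
      (by linear_combination -h) (by linear_combination h)
  · exact hS.of_ratio_four ha hd hc hb had hac hcd.symm hbd.symm hbc.symm
      (by linear_combination -3 * h) (by linear_combination 3 * h)
  · exact hS.of_ratio_four ha hb hd hc hab had hbd hbc hcd.symm
      (by linear_combination -h) (by linear_combination h)
  · exact hS.of_ratio_four ha hc hd hb hac had hcd hbc.symm hbd.symm
      (by linear_combination 4 * h) (by linear_combination -4 * h)
  · exact hS.of_ratio_four ha hb hc hd hab hac hbc hbd hcd
      (by linear_combination -3 * h) (by linear_combination 3 * h)
  · exact hS.of_ratio_four ha hc hb hd hac hab hbc.symm hcd hbd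
      (by linear_combination 4 * h) (by linear_combination -4 * h)

end

/-! ### From a rational quadruple to four roots of unity. -/

theorem isSuperrectangularOrDodecagonal_of_quadruple {V : Submodule ℚ ℂ}
    (hV : Module.finrank ℚ V = 2) {v : Fin 4 → ℂ} (hv : IsRationalTuple V v) :
    IsSuperrectangularOrDodecagonal V := by
  obtain ⟨hmem, hang⟩ := hv
  have hv0 : ∀ i, v i ≠ 0 := by
    intro i
    obtain ⟨j, hj⟩ : ∃ j : Fin 4, i ≠ j := exists_ne i |>.imp fun _ h => h.symm
    exact (hang i j hj).1
  have hc0 : ∀ i, conj (v i) ≠ 0 := fun i => by simpa using hv0 i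
  have him : ∀ i j, i ≠ j → (v j / v i).im ≠ 0 := fun i j hij => (hang i j hij).2.2.1
  set l : ℂ := conj (v 0) / v 0 with hl
  have hl0 : l ≠ 0 := div_ne_zero (hc0 0) (hv0 0)
  have hroot : ∀ i, IsRootOfUnity (l * (v i / conj (v i))) := by
    intro i
    by_cases hi : i = 0
    · subst hi
      refine ⟨1, one_pos, ?_⟩
      have := hc0 0
      have := hv0 0
      rw [hl]
      field_simp
    · obtain ⟨q, hq⟩ := (hang 0 i (Ne.symm hi)).2.2.2
      have := isRootOfUnity_div_conj (div_ne_zero (hv0 i) (hv0 0)) hq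
      convert this using 1
      have := hc0 0
      have := hv0 0
      have := hc0 i
      rw [hl, map_div₀]
      field_simp
  have halg : ∀ i, l * (v i / conj (v i)) ∈ algebraicClosure ℚ ℂ := by
    intro i
    obtain ⟨n, hn, h⟩ := hroot i
    rw [mem_algebraicClosure_iff']
    exact IsIntegral.of_pow hn (by rw [h]; exact isIntegral_one)
  let x : Fin 4 → AlgNumber := fun i => ⟨l * (v i / conj (v i)), halg i⟩
  have hx : ∀ i, (x i : ℂ) = l * (v i / conj (v i)) := fun i => rfl
  have hinj : ∀ i j, i ≠ j → x i ≠ x j := by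
    intro i j hij h
    apply him i j hij
    rw [im_div_eq_zero_iff (hv0 i)]
    have h' := mul_left_cancel₀ hl0 (congrArg (fun z : AlgNumber => (z : ℂ)) h)
    rwa [div_eq_div_iff (hc0 i) (hc0 j)] at h'
  have hS : IsDirectionSet V (Set.range x) := by
    refine ⟨?_, ?_⟩
    · rintro _ ⟨i, rfl⟩
      obtain ⟨n, hn, h⟩ := hroot i
      exact ⟨n, hn, Subtype.ext (by simpa using h)⟩
    · rintro _ ⟨i, rfl⟩ _ ⟨j, rfl⟩ _ ⟨k, rfl⟩ hij hik hjk
      exact homothetic_triangleRatio hV hl0 (hmem i) (hmem j) (hmem k)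
        (him i j (ne_of_apply_ne x hij)) (him i k (ne_of_apply_ne x hik))
        (him j k (ne_of_apply_ne x hjk))
  obtain ⟨r, s, h2⟩ := exists_rat_combination hV (hmem 0) (hmem 1) (hmem 2) (him 0 1 (by decide))
  obtain ⟨r', s', h3⟩ := exists_rat_combination hV (hmem 0) (hmem 1) (hmem 3) (him 0 1 (by decide))
  have hs : s ≠ 0 := by
    rintro rfl
    apply him 0 2 (by decide)
    rw [h2]
    simp [hv0 0]
  have hr' : r' ≠ 0 := by
    rintro rfl
    apply him 1 3 (by decide)
    rw [h3]
    simp [hv0 1]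
  -- In the basis `v 0`, `v 1` the vectors have coordinates (1,0), (0,1), (r,s), (r',s'); t is the
  -- cross-ratio formed from their 2×2 determinants.
  refine hS.of_rational_crossRatio (a := x 0) (b := x 1) (c := x 2) (d := x 3)
    ⟨0, rfl⟩ ⟨1, rfl⟩ ⟨2, rfl⟩ ⟨3, rfl⟩ (hinj _ _ (by decide)) (hinj _ _ (by decide))
    (hinj _ _ (by decide)) (hinj _ _ (by decide)) (hinj _ _ (by decide)) (hinj _ _ (by decide))
    (t := (r * s' - r' * s) / (s * r')) ?_
  -- Each difference is a determinant over a product of conjugates; every index occurs once on each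
  -- side of the cross-ratio relation, so the denominators cancel.
  have hdiff : ∀ i j, (x i : ℂ) - x j =
      l * (v i * conj (v j) - v j * conj (v i)) / (conj (v i) * conj (v j)) := by
    intro i j
    have := hc0 i
    have := hc0 j
    rw [hx, hx]
    field_simp
  have hsC : (s : ℂ) ≠ 0 := by exact_mod_cast hs
  have hrC : (r' : ℂ) ≠ 0 := by exact_mod_cast hr'
  have h2' : conj (v 2) = r * conj (v 0) + s * conj (v 1) := by rw [h2]; simp
  have h3' : conj (v 3) = r' * conj (v 0) + s' * conj (v 1) := by rw [h3]; simp
  have e23 : v 2 * conj (v 3) - v 3 * conj (v 2) =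
      (r * s' - r' * s) * (v 0 * conj (v 1) - v 1 * conj (v 0)) := by
    rw [h2', h3', h2, h3]; ring
  have e02 : v 0 * conj (v 2) - v 2 * conj (v 0) =
      s * (v 0 * conj (v 1) - v 1 * conj (v 0)) := by
    rw [h2', h2]; ring
  have e31 : v 3 * conj (v 1) - v 1 * conj (v 3) =
      r' * (v 0 * conj (v 1) - v 1 * conj (v 0)) := by
    rw [h3', h3]; ring
  have goalC : ((x 0 : ℂ) - x 1) * (x 2 - x 3) =
      (((r * s' - r' * s) / (s * r') : ℚ) : ℂ) * ((x 0 - x 2) * (x 3 - x 1)) := by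
    rw [hdiff, hdiff, hdiff, hdiff, e23, e02, e31]
    have k0 := hc0 0
    have k1 := hc0 1
    have k2 := hc0 2
    have k3 := hc0 3
    push_cast
    generalize v 0 * conj (v 1) - v 1 * conj (v 0) = δ
    field_simp
  apply Subtype.ext
  simpa using goalC

end RationalAngles

theorem theorem7p2 (V : Submodule ℚ ℂ) (hV : RationalAngles.IsSpace V)
    (hquad : ∃ v : Fin 4 → ℂ, RationalAngles.IsRationalTuple V v) :
    (∃ W : Submodule ℚ ℂ, RationalAngles.IsSuperrectangular W ∧ RationalAngles.Homothetic V W) ∨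
      RationalAngles.Homothetic V (RationalAngles.genSpace RationalAngles.tau₁) ∨
      RationalAngles.Homothetic V (RationalAngles.genSpace RationalAngles.tau₂) := by
  obtain ⟨v, hv⟩ := hquad
  rcases RationalAngles.isSuperrectangularOrDodecagonal_of_quadruple hV.1 hv with h | h
  · exact .inl ⟨V, ⟨hV, h⟩, RationalAngles.homothetic_self V⟩
  · exact .inr h
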